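/- Let $d\ge 3$, and let $L\in\mathbb{C}[X_0,X_1]$ be a fixed nonzero form of degree $d-1$. For forms $L_2\in\mathbb{C}[X_0,X_1,X_2]$ and $L_3\in\mathbb{C}[X_0,X_1,X_2,X_3]$ of degree $d-2$, let $X\subset\mathbb{P}^3=\mathbb{P}^3_{\mathbb{C}}$ be the surface of degree $d$ with the equation $$X_2\bigl(X_3L_3(X_0,X_1,X_2,X_3)+X_2L_2(X_0,X_1,X_2)+L(X_0,X_1)\bigr)+X_3^d=0,$$ and let $\Lambda\subset X$ be the line $X_2=X_3=0$. A smooth point $P$ of $X$ is called a star point if the intersection of $X$ with its embedded tangent plane $T_P(X)$ is a cone with vertex $P$. A point of $X$ is a singularity of type $A_k$ ($k\ge 1$) if the germ of $X$ at this point is analytically isomorphic to the germ at the origin of the surface $w_0^{k+1}+w_1^2+w_2^2=0$ in $\mathbb{C}^3$. Then for general $L_2,L_3$, that is, for all pairs $(L_2,L_3)$ in a nonempty Zariski open subset (depending on $d$ and $L$) of the vector space of pairs of forms of degree $d-2$, the following hold. Each smooth point of $X$ on $\Lambda$ is a star point of $X$. Each singular point $P=(a:b:0:0)$ of $X$ on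 $\Lambda$ is a singularity of type $A_{k(P)}$ with $k(P)=d\alpha-1$, where $\alpha\ge 1$ is the multiplicity of $(a:b)$ as a root of $L$. The set $\Lambda\cap\mathrm{Sing}(X)$ is finite, and $$\sum_{P\in\Lambda\cap\mathrm{Sing}(X)}\frac{k(P)+1}{d}=d-1.$$ -/

import Mathlib

open scoped LinearAlgebra.Projectivization

noncomputable section

/-- Complex projective 3-space, with homogeneous coordinates `(X₀ : X₁ : X₂ : X₃)`. -/
abbrev P3 : Type := ℙ ℂ (Fin 4 → ℂ)

/-- The hypersurface in `P3` defined by a form `f`. (For homogeneous `f` the vanishing of `f` at a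
point does not depend on the representative of the point.) -/
def projHypersurface (f : MvPolynomial (Fin 4) ℂ) : Set P3 :=
  {P | MvPolynomial.eval P.rep f = 0}

/-- The singular points of the hypersurface `f = 0`: all first partial derivatives vanish. -/
def singLocus (f : MvPolynomial (Fin 4) ℂ) : Set P3 :=
  {P | P ∈ projHypersurface f ∧ ∀ i, MvPolynomial.eval P.rep (MvPolynomial.pderiv i f) = 0}

/-- The linear subspace of `ℂ⁴` whose projectivization is the embedded tangent space of `f = 0`
at the (smooth) point `P`: it has the equation `∑ᵢ (∂f/∂Xᵢ)(P) Xᵢ = 0`. -/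
def embeddedTangentSpace (f : MvPolynomial (Fin 4) ℂ) (P : P3) : Submodule ℂ (Fin 4 → ℂ) where
  carrier := {v | ∑ i, MvPolynomial.eval P.rep (MvPolynomial.pderiv i f) * v i = 0}
  add_mem' := by
    intro v w hv hw
    simp only [Set.mem_ofPred_eq, Pi.add_apply, mul_add, Finset.sum_add_distrib] at *
    rw [hv, hw, add_zero]
  zero_mem' := by simp
  smul_mem' := by
    intro c v hv
    simp only [Set.mem_ofPred_eq, Pi.smul_apply, smul_eq_mul, mul_left_comm _ c] at *
    rw [← Finset.mul_sum, hv, mul_zero]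

/-- The intersection of `f = 0` with the projectivization of the linear subspace `T` is, as a
scheme, a cone with vertex `P ∈ T`: the form `f` restricted to `T` is constant in the direction
of `P`, that is, in linear coordinates on `T` in which `P = (1 : 0 : ⋯ : 0)`, it does not involve
the first coordinate. -/
def IsConeInWithVertex (f : MvPolynomial (Fin 4) ℂ) (T : Submodule ℂ (Fin 4 → ℂ)) (P : P3) :
    Prop :=
  P.rep ∈ T ∧ ∀ v ∈ T, ∀ t : ℂ,
    MvPolynomial.eval (v + t • P.rep) f = MvPolynomial.eval v f

/-- `P` is a star point of `f = 0`: it is a smooth point of this hypersurface, and the intersection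
of the hypersurface with its tangent space at `P` is a cone with vertex `P`. -/
def IsStarPoint (f : MvPolynomial (Fin 4) ℂ) (P : P3) : Prop :=
  P ∈ projHypersurface f ∧ P ∉ singLocus f ∧ IsConeInWithVertex f (embeddedTangentSpace f P) P

/-- The germ at `a` of the hypersurface `g = 0` in `ℂ³` is isomorphic to the germ at `0` of
`w₀ ^ (k + 1) + w₁ ^ 2 + w₂ ^ 2 = 0`: for some local biholomorphism `φ : (ℂ³, 0) → (ℂ³, a)`, the
function `g ∘ φ` is the product of this normal form with a nowhere vanishing holomorphic function
`u` near `0`. -/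
def IsTypeAGerm (k : ℕ) (g : (Fin 3 → ℂ) → ℂ) (a : Fin 3 → ℂ) : Prop :=
  1 ≤ k ∧
  ∃ (φ : (Fin 3 → ℂ) → (Fin 3 → ℂ)) (φ' : (Fin 3 → ℂ) ≃L[ℂ] (Fin 3 → ℂ))
    (u : (Fin 3 → ℂ) → ℂ),
    AnalyticAt ℂ φ 0 ∧ φ 0 = a ∧
    HasFDerivAt φ (φ' : (Fin 3 → ℂ) →L[ℂ] (Fin 3 → ℂ)) 0 ∧
    AnalyticAt ℂ u 0 ∧ u 0 ≠ 0 ∧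
    ∀ᶠ w in nhds (0 : Fin 3 → ℂ), g (φ w) = u w * (w 0 ^ (k + 1) + w 1 ^ 2 + w 2 ^ 2)

/-- `P` is a singularity of type `A_k` of the surface `f = 0`, tested in an affine chart `Xᵢ ≠ 0`
around `P`, with the affine coordinates `Xⱼ / Xᵢ` for `j ≠ i`. (The choice of the chart does not
matter: a change of charts is a biholomorphism and changes the equation by a unit.) -/
def IsTypeA (k : ℕ) (f : MvPolynomial (Fin 4) ℂ) (P : P3) : Prop :=
  ∃ i : Fin 4, P.rep i ≠ 0 ∧
    IsTypeAGerm k (fun x => MvPolynomial.eval (i.insertNth (1 : ℂ) x : Fin 4 → ℂ) f)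
      (fun j => P.rep (i.succAbove j) / P.rep i)

/-- The line `X₂ = X₃ = 0`. -/
def lineLambda : Set P3 := {P | P.rep 2 = 0 ∧ P.rep 3 = 0}

/-- The multiplicity of `(a : b)` as a root of the nonzero binary form `L(X₀, X₁)`: the exponent of
the linear form `b X₀ - a X₁` in `L`. -/
def binaryRootMultiplicity (L : MvPolynomial (Fin 2) ℂ) (a b : ℂ) : ℕ :=
  multiplicity (MvPolynomial.C b * MvPolynomial.X 0 - MvPolynomial.C a * MvPolynomial.X 1) L

/-- The polynomial `X₂ (X₃ L₃(X₀,X₁,X₂,X₃) + X₂ L₂(X₀,X₁,X₂) + L(X₀,X₁)) + X₃ ^ d`. -/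
def surfaceForm (d : ℕ) (L : MvPolynomial (Fin 2) ℂ) (L₂ : MvPolynomial (Fin 3) ℂ)
    (L₃ : MvPolynomial (Fin 4) ℂ) : MvPolynomial (Fin 4) ℂ :=
  MvPolynomial.X 2 *
      (MvPolynomial.X 3 * L₃
        + MvPolynomial.X 2 * MvPolynomial.rename (Fin.castLE (by norm_num) : Fin 3 → Fin 4) L₂
        + MvPolynomial.rename (Fin.castLE (by norm_num) : Fin 2 → Fin 4) L)
    + MvPolynomial.X 3 ^ d

/-- The exponents of the monomials of degree `e` in `n` variables. -/
abbrev MonomialIndex (n e : ℕ) : Type := {m : Fin n →₀ ℕ // m.degree = e}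

/-- The property `Q` holds for general ternary and quaternary forms `L₂`, `L₃` of degree `e`: it
holds for all pairs in some nonempty Zariski open subset of the vector space of pairs of such
forms, namely for those at whose coefficients a certain nonzero polynomial `G` does not vanish. -/
def ForGeneralForms (e : ℕ)
    (Q : MvPolynomial (Fin 3) ℂ → MvPolynomial (Fin 4) ℂ → Prop) : Prop :=
  ∃ G : MvPolynomial (MonomialIndex 3 e ⊕ MonomialIndex 4 e) ℂ, G ≠ 0 ∧
    ∀ (L₂ : MvPolynomial (Fin 3) ℂ) (L₃ : MvPolynomial (Fin 4) ℂ),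
      L₂.IsHomogeneous e → L₃.IsHomogeneous e →
      MvPolynomial.eval (Sum.elim (fun m => L₂.coeff m.1) (fun m => L₃.coeff m.1)) G ≠ 0 →
      Q L₂ L₃

end

/-! Along Λ the gradient of the equation is (0, 0, L, 0). So the singular points on Λ are the roots
of L, and at every other point of Λ the tangent plane is X₂ = 0. It cuts out X₃ ^ d = 0, a cone with
vertex at any point of Λ, whatever L₂ and L₃ are.

At a root of multiplicity α, affine coordinates X, y, z centred there give the equation y (z M + y N
+ X ^ α h) + z ^ d, with h a unit and M given by L₃. The only genericity condition is that L₃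
vanishes at no root of L, so that M is a unit. With ζ = -X ^ α h / M and s = z - ζ the equation
reads N y² + M y s + T s² + d ζ ^ (d - 1) s + ζ ^ d, where T is analytic and vanishes at the point
because d ≥ 3. The discriminant M² - 4 N T is therefore a unit. Completing the square leaves ζ ^ d
times a unit, that is X ^ (d α) times a unit, whence type A_{dα - 1} (`isTypeAGerm_of_unit`, through
the inverse function theorem in `isTypeAGerm_of_coordinates`).

Thus (k(P) + 1) / d = α, and the sum formula says that the root multiplicities of L add up to deg L
= d - 1 (`finsum_binaryRootMultiplicity`). -/

/-! ### Local normal forms of type A -/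

/-- Dividing by `u a` moves the value at `a` to 1, where the principal branch of the root is
analytic. -/
theorem AnalyticAt.exists_pow_eq_of_ne_zero {E : Type*} [NormedAddCommGroup E] [NormedSpace ℂ E]
    {u : E → ℂ} {a : E} (hu : AnalyticAt ℂ u a) (ha : u a ≠ 0) {n : ℕ} (hn : n ≠ 0) :
    ∃ v : E → ℂ, AnalyticAt ℂ v a ∧ v a ≠ 0 ∧ (∀ x, v x ^ n = u x) := by
  obtain ⟨c, hc⟩ := IsAlgClosed.exists_pow_nat_eq (u a) (Nat.pos_of_ne_zero hn)
  have hc0 : c ≠ 0 := by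
    rintro rfl
    exact ha (by rw [← hc, zero_pow hn])
  refine ⟨fun x => c * (u x / u a) ^ ((n : ℂ)⁻¹), ?_, ?_, fun x => ?_⟩
  · refine analyticAt_const.mul ((hu.div analyticAt_const ha).cpow analyticAt_const ?_)
    simp [ha]
  · simp [ha, hc0]
  · rw [mul_pow, Complex.cpow_nat_inv_pow _ hn, hc, mul_div_cancel₀ _ ha]

/-- A coordinate system in which a function takes the normal form of an `A_k` singularity, given by
a matrix of analytic coefficients with respect to `x - a`, exhibits the singularity. -/
theorem isTypeAGerm_of_coordinates {k : ℕ} (hk : 1 ≤ k) {g : (Fin 3 → ℂ) → ℂ} {a : Fin 3 → ℂ}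
    (C : Fin 3 → Fin 3 → (Fin 3 → ℂ) → ℂ) (hC : ∀ i j, AnalyticAt ℂ (C i j) a)
    (hinj : ∀ v : Fin 3 → ℂ, (∀ i, ∑ j, C i j a * v j = 0) → v = 0)
    (hg : ∀ᶠ x in nhds a, g x = (∑ j, C 0 j x * (x j - a j)) ^ (k + 1)
      + (∑ j, C 1 j x * (x j - a j)) ^ 2 + (∑ j, C 2 j x * (x j - a j)) ^ 2) :
    IsTypeAGerm k g a := by
  set Ψ : (Fin 3 → ℂ) → (Fin 3 → ℂ) := fun x i => ∑ j, C i j x * (x j - a j) with hΨdef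
  have hproj : ∀ j : Fin 3, AnalyticAt ℂ (fun x : Fin 3 → ℂ => x j) a := fun j =>
    (ContinuousLinearMap.proj (R := ℂ) (φ := fun _ : Fin 3 => ℂ) j).analyticAt a
  have hΨan : AnalyticAt ℂ Ψ a := by
    refine analyticAt_pi_iff.2 fun i => ?_
    refine Finset.analyticAt_fun_sum _ fun j _ => ?_
    exact (hC i j).mul ((hproj j).sub analyticAt_const)
  have hΨa : Ψ a = 0 := by
    ext i
    simp [hΨdef]
  -- The derivative of `C i j` drops out at `a`, being multiplied by `a j - a j`.
  have hder : ∀ v i, fderiv ℂ Ψ a v i = ∑ j, C i j a * v j := by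
    intro v i
    have h1 : HasFDerivAt Ψ (ContinuousLinearMap.pi fun i => ∑ j,
        (C i j a • (ContinuousLinearMap.proj (R := ℂ) (φ := fun _ : Fin 3 => ℂ) j)
          + (a j - a j) • fderiv ℂ (C i j) a)) a := by
      refine hasFDerivAt_pi.2 fun i => ?_
      refine HasFDerivAt.fun_sum fun j _ => ?_
      refine (hC i j).differentiableAt.hasFDerivAt.mul ?_
      exact (ContinuousLinearMap.proj (R := ℂ) (φ := fun _ : Fin 3 => ℂ) j).hasFDerivAt.sub_const _
    rw [h1.fderiv]
    simp
  have hker : Function.Injective (fderiv ℂ Ψ a : (Fin 3 → ℂ) →ₗ[ℂ] (Fin 3 → ℂ)) := by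
    refine (injective_iff_map_eq_zero _).2 fun v hv => hinj v fun i => ?_
    rw [← hder v i]
    exact congrFun hv i
  let e : (Fin 3 → ℂ) ≃L[ℂ] (Fin 3 → ℂ) :=
    (LinearEquiv.ofInjectiveEndo _ hker).toContinuousLinearEquiv
  have he : (e : (Fin 3 → ℂ) →L[ℂ] (Fin 3 → ℂ)) = fderiv ℂ Ψ a := by
    ext v
    rfl
  have hΨd : HasFDerivAt Ψ (e : (Fin 3 → ℂ) →L[ℂ] (Fin 3 → ℂ)) a := by
    rw [he]
    exact hΨan.differentiableAt.hasFDerivAt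
  -- The exponent `⊤` means analyticity, which the local inverse inherits.
  have hcd : ContDiffAt ℂ ⊤ Ψ a := hΨan.contDiffAt
  have hne : (⊤ : WithTop ℕ∞) ≠ 0 := by simp
  have hst : HasStrictFDerivAt Ψ (e : (Fin 3 → ℂ) →L[ℂ] (Fin 3 → ℂ)) a :=
    hcd.hasStrictFDerivAt' hΨd hne
  refine ⟨hk, hcd.localInverse hΨd hne, e.symm, fun _ => 1, ?_, ?_, ?_, analyticAt_const,
    one_ne_zero, ?_⟩
  · have := hcd.to_localInverse hΨd hne
    rw [hΨa] at this
    exact this.analyticAt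
  · have := hst.localInverse_apply_image
    rw [hΨa] at this
    exact this
  · have := hst.to_localInverse.hasFDerivAt
    rw [hΨa] at this
    exact this
  · have hright := hst.eventually_right_inverse
    have htend := hst.localInverse_tendsto
    rw [hΨa] at hright htend
    filter_upwards [hright, htend.eventually hg] with w hw1 hw2
    rw [one_mul]
    change g (hst.localInverse Ψ e a w) = _
    rw [hw2]
    change Ψ _ 0 ^ (k + 1) + Ψ _ 1 ^ 2 + Ψ _ 2 ^ 2 = _
    rw [hw1]

/-- The remainder of the binomial expansion of `(s + z) ^ d` to first order in `s`. -/
theorem exists_analytic_add_pow_remainder {d : ℕ} (hd : 3 ≤ d) :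
    ∃ T : ℂ × ℂ → ℂ, (∀ q, AnalyticAt ℂ T q) ∧ T 0 = 0 ∧
      ∀ s z : ℂ, (s + z) ^ d = z ^ d + d * z ^ (d - 1) * s + s ^ 2 * T (s, z) := by
  induction d, hd using Nat.le_induction with
  | base =>
    refine ⟨fun q => q.1 + 3 * q.2, fun q => ?_, by simp, fun s z => ?_⟩
    · exact analyticAt_fst.add (analyticAt_const.mul analyticAt_snd)
    · norm_num
      ring
  | succ d hd ih =>
    obtain ⟨T, hT, hT0, h⟩ := ih
    -- The coefficient of s² in (s + z) (z ^ d + d z ^ (d - 1) s + s² T).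
    refine ⟨fun q => d * q.2 ^ (d - 1) + (q.1 + q.2) * T q, fun q => ?_, ?_, fun s z => ?_⟩
    · exact (analyticAt_const.mul (analyticAt_snd.pow _)).add
        ((analyticAt_fst.add analyticAt_snd).mul (hT q))
    · simp [hT0, show d - 1 ≠ 0 by omega]
    · obtain ⟨e, rfl⟩ : ∃ e, d = e + 1 := ⟨d - 1, by omega⟩
      rw [pow_succ, h]
      simp only [Nat.add_sub_cancel]
      push_cast
      ring

/-- The germ of `y (z M + y N + (x - p) ^ α h) + z ^ d` with units `M`, `h` is of type
`A_{dα - 1}`. -/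
theorem isTypeAGerm_of_unit {d α : ℕ} (hd : 3 ≤ d) (hα : 1 ≤ α) {a : Fin 3 → ℂ}
    (ha1 : a 1 = 0) (ha2 : a 2 = 0) {M N h : (Fin 3 → ℂ) → ℂ}
    (hM : AnalyticAt ℂ M a) (hN : AnalyticAt ℂ N a) (hh : AnalyticAt ℂ h a)
    (hM0 : M a ≠ 0) (hh0 : h a ≠ 0) :
    IsTypeAGerm (d * α - 1)
      (fun x => x 1 * (x 2 * M x + x 1 * N x + (x 0 - a 0) ^ α * h x) + x 2 ^ d) a := by
  have hproj : ∀ j : Fin 3, AnalyticAt ℂ (fun x : Fin 3 → ℂ => x j) a := fun j =>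
    (ContinuousLinearMap.proj (R := ℂ) (φ := fun _ : Fin 3 => ℂ) j).analyticAt a
  have hx0 := hproj 0
  have hx2 := hproj 2
  obtain ⟨T₁, hT₁, hT₁0, hexp⟩ := exists_analytic_add_pow_remainder hd
  obtain ⟨β, rfl⟩ : ∃ β, α = β + 1 := ⟨α - 1, by omega⟩
  obtain ⟨e, rfl⟩ : ∃ e, d = e + 3 := ⟨d - 3, by omega⟩
  have hpos : (e + 3) * (β + 1) ≠ 0 := by positivity
  -- the function `ζ₁` with `ζ = (x₀ - a₀) ζ₁`, and `s = x₂ - ζ`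
  obtain ⟨ζ₁, hζ₁def⟩ : ∃ ζ₁ : (Fin 3 → ℂ) → ℂ, ζ₁ = fun x => -((x 0 - a 0) ^ β * h x / M x) :=
    ⟨_, rfl⟩
  have hζ₁ : AnalyticAt ℂ ζ₁ a := by
    rw [hζ₁def]
    exact ((((hx0.sub analyticAt_const).pow β).mul hh).div hM hM0).neg
  have hζ : AnalyticAt ℂ (fun x => (x 0 - a 0) * ζ₁ x) a := (hx0.sub analyticAt_const).mul hζ₁
  obtain ⟨T, hTdef⟩ : ∃ T : (Fin 3 → ℂ) → ℂ,
      T = fun x => T₁ (x 2 - (x 0 - a 0) * ζ₁ x, (x 0 - a 0) * ζ₁ x) := ⟨_, rfl⟩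
  have hT : AnalyticAt ℂ T a := by
    rw [hTdef]
    exact (hT₁ _).fun_comp (f := fun x : Fin 3 → ℂ =>
      (x 2 - (x 0 - a 0) * ζ₁ x, (x 0 - a 0) * ζ₁ x)) ((hx2.sub hζ).prod hζ)
  have hT0 : T a = 0 := by
    simp only [hTdef, ha2, sub_self, zero_mul]
    exact hT₁0
  -- Discriminant of the form N y² + M y s + T s².
  obtain ⟨D, hDdef⟩ : ∃ D : (Fin 3 → ℂ) → ℂ, D = fun x => M x ^ 2 - 4 * N x * T x := ⟨_, rfl⟩
  have hD : AnalyticAt ℂ D a := by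
    rw [hDdef]
    fun_prop
  have hDa : D a = M a ^ 2 := by simp [hDdef, hT0]
  have hD0 : D a ≠ 0 := by
    rw [hDa]
    exact pow_ne_zero _ hM0
  -- The sign of the root matters: with r(a) = -M(a) the function `M'` below would vanish at a.
  obtain ⟨r, hr, hra, hrD⟩ : ∃ r : (Fin 3 → ℂ) → ℂ,
      AnalyticAt ℂ r a ∧ r a = M a ∧ ∀ x, r x ^ 2 = D x := by
    obtain ⟨r, hr, -, hrD⟩ := hD.exists_pow_eq_of_ne_zero hD0 two_ne_zero
    rcases sq_eq_sq_iff_eq_or_eq_neg.1 ((hrD a).trans hDa) with h1 | h1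
    · exact ⟨r, hr, h1, hrD⟩
    · exact ⟨fun x => -r x, hr.neg, by simp [h1], fun x => by rw [neg_sq, hrD]⟩
  -- A root of λ² - M λ + N T. With τ = T / M' it gives M = M' + N τ, so the form in (Y, S) factors
  -- as (M' S + N Y) (Y + τ S).
  obtain ⟨M', hM'def⟩ : ∃ M' : (Fin 3 → ℂ) → ℂ, M' = fun x => (M x + r x) / 2 := ⟨_, rfl⟩
  have hM' : AnalyticAt ℂ M' a := by
    rw [hM'def]
    exact (hM.add hr).div analyticAt_const two_ne_zero
  have hM'a : M' a = M a := by simp [hM'def, hra]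
  have hM'0 : M' a ≠ 0 := by rwa [hM'a]
  -- `t / D = (x₀ - a₀) ρ` for the linear coefficient `t = d ζ ^ (d - 1)`
  obtain ⟨ρ, hρdef⟩ : ∃ ρ : (Fin 3 → ℂ) → ℂ, ρ = fun x =>
      ((e : ℂ) + 3) * ((x 0 - a 0) * ζ₁ x) ^ (e + 1) * ζ₁ x / D x := ⟨_, rfl⟩
  have hρ : AnalyticAt ℂ ρ a := by
    rw [hρdef]
    exact ((analyticAt_const.mul (hζ.pow _)).mul hζ₁).div hD hD0
  have hρ0 : ρ a = 0 := by simp [hρdef]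
  obtain ⟨τ, hτdef⟩ : ∃ τ : (Fin 3 → ℂ) → ℂ, τ = fun x => T x / M' x := ⟨_, rfl⟩
  have hτ : AnalyticAt ℂ τ a := by
    rw [hτdef]
    exact hT.div hM' hM'0
  have hτ0 : τ a = 0 := by simp [hτdef, hT0]
  -- For t = d ζ ^ (d - 1), completing the square leaves ζ ^ d + N t² / D, which equals (x₀ - a₀) ^
  -- (dα) U.
  obtain ⟨U, hUdef⟩ : ∃ U : (Fin 3 → ℂ) → ℂ, U = fun x => (-(h x / M x)) ^ (e + 3) *
      (1 + ((e : ℂ) + 3) ^ 2 * ((x 0 - a 0) * ζ₁ x) ^ (e + 1) * N x / D x) := ⟨_, rfl⟩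
  have hU : AnalyticAt ℂ U a := by
    rw [hUdef]
    exact ((hh.div hM hM0).neg.pow _).mul (analyticAt_const.add
      (((analyticAt_const.mul (hζ.pow _)).mul hN).div hD hD0))
  have hU0 : U a ≠ 0 := by simp [hUdef, hh0, hM0]
  obtain ⟨v, hv, hv0, hvU⟩ := hU.exists_pow_eq_of_ne_zero hU0 hpos
  -- With c = t / D the linear term disappears in Y = y + M c, S = s - 2 N c, and S = x₂ + (x₀ - a₀)
  -- ε. `A` and `B` are the coefficients of the two factors with respect to x - a.
  obtain ⟨ε, hεdef⟩ : ∃ ε : (Fin 3 → ℂ) → ℂ, ε = fun x => -ζ₁ x - 2 * N x * ρ x := ⟨_, rfl⟩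
  have hε : AnalyticAt ℂ ε a := by
    rw [hεdef]
    fun_prop
  let A : Fin 3 → (Fin 3 → ℂ) → ℂ :=
    ![fun x => M' x * ε x + N x * (M x * ρ x), N, M']
  let B : Fin 3 → (Fin 3 → ℂ) → ℂ :=
    ![fun x => M x * ρ x + τ x * ε x, fun _ => 1, τ]
  have hA : ∀ j, AnalyticAt ℂ (A j) a := by
    intro j
    fin_cases j
    · exact (hM'.mul hε).add (hN.mul (hM.mul hρ))
    · exact hN
    · exact hM'
  have hB : ∀ j, AnalyticAt ℂ (B j) a := by
    intro j
    fin_cases j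
    · exact (hM.mul hρ).add (hτ.mul hε)
    · exact analyticAt_const
    · exact hτ
  refine isTypeAGerm_of_coordinates (k := (e + 3) * (β + 1) - 1) ?_
    ![![v, fun _ => 0, fun _ => 0], fun j x => (A j x + B j x) / 2,
      fun j x => (A j x - B j x) / (2 * Complex.I)] ?_ ?_ ?_
  · have : 3 * 1 ≤ (e + 3) * (β + 1) := Nat.mul_le_mul (by omega) (by omega)
    omega
  · intro i j
    fin_cases i
    · fin_cases j
      · exact hv
      · exact analyticAt_const
      · exact analyticAt_const
    · exact ((hA j).add (hB j)).div analyticAt_const two_ne_zero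
    · exact ((hA j).sub (hB j)).div analyticAt_const (by simp)
  · intro w hw
    have h0 := hw 0
    have h1 := hw 1
    have h2 := hw 2
    -- As ρ and τ vanish at a, the second factor has linear part x₁ there, and the first contains x₂
    -- with coefficient M'(a) ≠ 0.
    simp only [Fin.sum_univ_three, Matrix.cons_val, A, B, hρ0, hτ0] at h0 h1 h2
    have e0 : w 0 = 0 := by simpa [hv0] using h0
    simp only [e0] at h1 h2
    field_simp at h1 h2
    have e1 : w 1 = 0 := by linear_combination (h1 - h2) / 2
    have e2 : w 2 = 0 := by
      have : M' a * w 2 = 0 := by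
        rw [e1] at h1 h2
        linear_combination (h1 + h2) / 2
      exact (mul_eq_zero.1 this).resolve_left hM'0
    ext i
    fin_cases i
    · exact e0
    · exact e1
    · exact e2
  · rw [Nat.sub_add_cancel (Nat.one_le_iff_ne_zero.2 hpos)]
    filter_upwards [hM.continuousAt.eventually_ne hM0, hD.continuousAt.eventually_ne hD0,
      hM'.continuousAt.eventually_ne hM'0] with x hMx hDx hM'x
    have hsq : ∀ P Q : ℂ, ((P + Q) / 2) ^ 2 + ((P - Q) / (2 * Complex.I)) ^ 2 = P * Q := by
      intro P Q
      rw [div_pow, div_pow, mul_pow, Complex.I_sq]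
      ring
    have h1 : ∑ j, (A j x + B j x) / 2 * (x j - a j)
        = (∑ j, A j x * (x j - a j) + ∑ j, B j x * (x j - a j)) / 2 := by
      rw [← Finset.sum_add_distrib, Finset.sum_div]
      exact Finset.sum_congr rfl fun j _ => by ring
    have h2 : ∑ j, (A j x - B j x) / (2 * Complex.I) * (x j - a j)
        = (∑ j, A j x * (x j - a j) - ∑ j, B j x * (x j - a j)) / (2 * Complex.I) := by
      rw [← Finset.sum_sub_distrib, Finset.sum_div]
      exact Finset.sum_congr rfl fun j _ => by ring
    simp only [Matrix.cons_val]
    rw [h1, h2, add_assoc ((_ : ℂ) ^ ((e + 3) * (β + 1))), hsq]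
    simp only [Fin.sum_univ_three, Matrix.cons_val, zero_mul, add_zero, ha1, ha2, sub_zero, A, B]
    set X := x 0 - a 0 with hX
    obtain ⟨ζ, hζx⟩ : ∃ ζ, ζ = X * ζ₁ x := ⟨_, rfl⟩
    have hζh : X ^ (β + 1) * h x = -(M x * ζ) := by
      rw [hζx, hζ₁def]
      simp only [← hX]
      field_simp
      ring
    have hζU : X * -(X ^ β * (h x / M x)) = ζ := by
      rw [hζx, hζ₁def]
      ring
    obtain ⟨c, hcx⟩ : ∃ c, c = ρ x * X := ⟨_, rfl⟩
    have hc : D x * c = ((e : ℂ) + 3) * ζ ^ (e + 2) := by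
      rw [hcx, hρdef, hζx]
      simp only [← hX]
      field_simp
      ring
    have hpow : (v x * X) ^ ((e + 3) * (β + 1)) = ζ ^ (e + 3) + D x * c ^ 2 * N x := by
      have : X ^ ((e + 3) * (β + 1)) * (-(h x / M x)) ^ (e + 3) = ζ ^ (e + 3) := by
        rw [← hζU, mul_comm (e + 3), pow_mul, ← mul_pow]
        ring
      rw [mul_pow, hvU]
      have hc2 : D x * c ^ 2 = ((e : ℂ) + 3) ^ 2 * ζ ^ (e + 1) * ζ ^ (e + 3) / D x := by
        rw [eq_div_iff hDx]
        linear_combination (D x * c + ((e : ℂ) + 3) * ζ ^ (e + 2)) * hc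
      rw [hc2, hUdef, ← this]
      simp only [← hX, ← hζx]
      ring
    have hz : x 2 ^ (e + 3) = ζ ^ (e + 3) + D x * c * (x 2 - ζ) + (x 2 - ζ) ^ 2 * T x := by
      have := hexp (x 2 - ζ) ζ
      rw [sub_add_cancel] at this
      rw [this, hc, hTdef]
      simp only [← hX, ← hζx]
      push_cast
      rfl
    have hM'M : M' x ^ 2 + N x * T x = M x * M' x := by
      have hD' : r x ^ 2 = M x ^ 2 - 4 * N x * T x := by rw [hrD, hDdef]
      rw [hM'def]
      linear_combination hD' / 4
    have hTτ : T x = M' x * τ x := by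
      rw [hτdef]
      field_simp
    have hMτ : M x = M' x + N x * τ x := by
      apply mul_left_cancel₀ hM'x
      linear_combination -hM'M + N x * hTτ
    have hεx : ε x * X = -ζ - 2 * N x * c := by
      rw [hεdef, hcx, hζx]
      ring
    have hDx' : D x = M x ^ 2 - 4 * N x * T x := by rw [hDdef]
    have hPA : (M' x * ε x + N x * (M x * ρ x)) * X + N x * x 1 + M' x * x 2
        = M' x * (x 2 - ζ - 2 * N x * c) + N x * (x 1 + M x * c) := by
      linear_combination M' x * hεx - N x * M x * hcx
    have hPB : (M x * ρ x + τ x * ε x) * X + 1 * x 1 + τ x * x 2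
        = (x 1 + M x * c) + τ x * (x 2 - ζ - 2 * N x * c) := by
      linear_combination τ x * hεx - M x * hcx
    rw [hPA, hPB, hpow, hz, hζh]
    have hq : ∀ Y S : ℂ, (M' x * S + N x * Y) * (Y + τ x * S)
        = N x * Y ^ 2 + M x * Y * S + T x * S ^ 2 := by
      intro Y S
      rw [hMτ, hTτ]
      ring
    rw [hq, hDx']
    ring

/-! ### Binary forms and the multiplicities of their roots -/

/-- A linear form in two variables vanishing at `(a, b)`. -/
noncomputable def binaryLinearForm (a b : ℂ) : MvPolynomial (Fin 2) ℂ :=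
  MvPolynomial.C b * MvPolynomial.X 0 - MvPolynomial.C a * MvPolynomial.X 1

open MvPolynomial in
theorem eval_binaryLinearForm (a b : ℂ) (v : Fin 2 → ℂ) :
    eval v (binaryLinearForm a b) = b * v 0 - a * v 1 := by
  simp [binaryLinearForm]

open MvPolynomial in
theorem isHomogeneous_binaryLinearForm (a b : ℂ) : (binaryLinearForm a b).IsHomogeneous 1 :=
  (isHomogeneous_C_mul_X b 0).sub (isHomogeneous_C_mul_X a 1)

theorem binaryLinearForm_ne_zero {a b : ℂ} (hab : a ≠ 0 ∨ b ≠ 0) : binaryLinearForm a b ≠ 0 := by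
  intro h
  have h0 := eval_binaryLinearForm a b ![1, 0]
  have h1 := eval_binaryLinearForm a b ![0, 1]
  rw [h] at h0 h1
  simp at h0 h1
  tauto

namespace MvPolynomial

/-- A form evaluated at a multiple of a point, in an arbitrary algebra. -/
theorem IsHomogeneous.aeval_mul_algebraMap {σ R A : Type*} [CommSemiring R] [CommSemiring A]
    [Algebra R A] {F : MvPolynomial σ R} {n : ℕ} (hF : F.IsHomogeneous n) (r : A) (v : σ → R) :
    MvPolynomial.aeval (fun i => r * algebraMap R A (v i)) F = r ^ n * algebraMap R A (eval v F) := by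
  rw [aeval_def, eval₂_eq, eval_eq, map_sum, Finset.mul_sum]
  refine Finset.sum_congr rfl fun m hm => ?_
  have hdeg : ∑ i ∈ m.support, m i = n := (hF.degree_eq_sum_deg_support hm).symm
  simp only [mul_pow, Finset.prod_mul_distrib, map_mul, map_prod, map_pow,
    Finset.prod_pow_eq_pow_sum, hdeg]
  ring

theorem IsHomogeneous.eval_smul {σ R : Type*} [CommSemiring R] {F : MvPolynomial σ R} {n : ℕ}
    (hF : F.IsHomogeneous n) (r : R) (v : σ → R) : eval (r • v) F = r ^ n * eval v F := by
  have := hF.aeval_mul_algebraMap (A := R) r v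
  simpa [Pi.smul_def] using this

/-- A binary form vanishing at a point is divisible by the linear form of this point. -/
theorem IsHomogeneous.binaryLinearForm_dvd {F : MvPolynomial (Fin 2) ℂ} {n : ℕ}
    (hF : F.IsHomogeneous n) {a b : ℂ} (hab : a ≠ 0 ∨ b ≠ 0) (h : eval ![a, b] F = 0) :
    binaryLinearForm a b ∣ F := by
  rw [← Ideal.mem_span_singleton, ← Ideal.Quotient.eq_zero_iff_mem]
  set I := Ideal.span {binaryLinearForm a b} with hI
  set q := Ideal.Quotient.mkₐ ℂ I with hq
  have hlin : algebraMap ℂ (MvPolynomial (Fin 2) ℂ ⧸ I) b * q (X 0)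
      = algebraMap ℂ (MvPolynomial (Fin 2) ℂ ⧸ I) a * q (X 1) := by
    have : q (binaryLinearForm a b) = 0 :=
      Ideal.Quotient.eq_zero_iff_mem.2 (Ideal.mem_span_singleton_self _)
    rw [binaryLinearForm, map_sub, map_mul, map_mul, sub_eq_zero] at this
    simpa [← algebraMap_eq] using this
  change q F = 0
  -- Modulo b X₀ - a X₁ the generic point (X₀, X₁) is a multiple r (a, b), so F becomes r ^ n F(a,
  -- b) = 0.
  have key : ∃ r, (fun i => q (X i)) = fun i => r * algebraMap ℂ _ ((![a, b] : Fin 2 → ℂ) i) := by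
    rcases hab with ha | hb
    · have e : algebraMap ℂ (MvPolynomial (Fin 2) ℂ ⧸ I) a⁻¹ * algebraMap ℂ _ a = 1 := by
        rw [← map_mul, inv_mul_cancel₀ ha, map_one]
      refine ⟨q (X 0) * algebraMap ℂ _ a⁻¹, _root_.funext fun i => ?_⟩
      fin_cases i
      · simp only [Fin.zero_eta, Matrix.cons_val_zero]
        linear_combination -(q (X 0)) * e
      · simp only [Fin.mk_one, Matrix.cons_val_one, Matrix.cons_val_fin_one]
        linear_combination -(q (X 1)) * e - algebraMap ℂ _ a⁻¹ * hlin
    · have e : algebraMap ℂ (MvPolynomial (Fin 2) ℂ ⧸ I) b⁻¹ * algebraMap ℂ _ b = 1 := by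
        rw [← map_mul, inv_mul_cancel₀ hb, map_one]
      refine ⟨q (X 1) * algebraMap ℂ _ b⁻¹, _root_.funext fun i => ?_⟩
      fin_cases i
      · simp only [Fin.zero_eta, Matrix.cons_val_zero]
        linear_combination -(q (X 0)) * e + algebraMap ℂ _ b⁻¹ * hlin
      · simp only [Fin.mk_one, Matrix.cons_val_one, Matrix.cons_val_fin_one]
        linear_combination -(q (X 1)) * e
  obtain ⟨r, hr⟩ := key
  have h1 : q F = MvPolynomial.aeval (fun i => q (X i)) F := by
    rw [aeval_unique q]
    simp [Function.comp_def]
  rw [h1, hr, hF.aeval_mul_algebraMap, h, map_zero, mul_zero]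

/-- A cofactor of a form in a form is a form. -/
theorem IsHomogeneous.exists_cofactor {σ : Type*} {F G : MvPolynomial σ ℂ} {m n : ℕ}
    (hF : F.IsHomogeneous n) (hG : G.IsHomogeneous m) (hF0 : F ≠ 0) (h : G ∣ F) :
    ∃ H : MvPolynomial σ ℂ, ∃ e, H.IsHomogeneous e ∧ F = G * H ∧ n = m + e := by
  obtain ⟨H, hH⟩ := h
  -- Comparing components of degree n, only the component of H of degree n - m contributes; it
  -- serves as the cofactor.
  have h1 : F = ∑ i ∈ Finset.range (H.totalDegree + 1),
      if m + i = n then G * homogeneousComponent i H else 0 := by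
    have h2 : homogeneousComponent n F = F := homogeneousComponent_eq_self hF
    conv_lhs => rw [← h2, hH, ← sum_homogeneousComponent H, Finset.mul_sum, map_sum]
    refine Finset.sum_congr rfl fun i _ => ?_
    rw [homogeneousComponent_of_mem (hG.mul (homogeneousComponent_isHomogeneous i H))]
    simp only [eq_comm]
  obtain ⟨i, -, hi⟩ := Finset.exists_ne_zero_of_sum_ne_zero (h1 ▸ hF0)
  obtain rfl : m + i = n := by
    by_contra hne
    exact hi (if_neg hne)
  refine ⟨homogeneousComponent i H, i, homogeneousComponent_isHomogeneous i H, ?_, rfl⟩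
  rw [if_pos rfl] at hi
  conv_lhs => rw [h1]
  rw [Finset.sum_eq_single i]
  · rw [if_pos rfl]
  · intro j _ hj
    exact if_neg (by omega)
  · intro hmem
    rw [if_pos rfl]
    rw [homogeneousComponent_eq_zero _ _ (by simpa using hmem), mul_zero]

theorem eval_aeval_polynomial (F : MvPolynomial (Fin 2) ℂ) (u w : Polynomial ℂ) (t : ℂ) :
    (MvPolynomial.aeval ![u, w] F).eval t = eval ![u.eval t, w.eval t] F := by
  induction F using MvPolynomial.induction_on with
  | C c => simp
  | add p q hp hq => simp [hp, hq]
  | mul_X p i hp => fin_cases i <;> simp [hp]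

/-- A binary form of positive degree over `ℂ` has a root. -/
theorem IsHomogeneous.exists_eval_eq_zero {F : MvPolynomial (Fin 2) ℂ} {n : ℕ}
    (hF : F.IsHomogeneous n) (hn : n ≠ 0) :
    ∃ a b : ℂ, (a ≠ 0 ∨ b ≠ 0) ∧ eval ![a, b] F = 0 := by
  by_contra! hcon
  -- Without roots F(t, 1) is a constant c. By homogeneity F(1, s) = c s ^ n for s ≠ 0, hence for
  -- all s, so (1, 0) is a root after all.
  have hdeg : (MvPolynomial.aeval ![Polynomial.X, 1] F : Polynomial ℂ).degree = 0 := by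
    by_contra h
    obtain ⟨t, ht⟩ := IsAlgClosed.exists_root _ h
    rw [Polynomial.IsRoot.def, eval_aeval_polynomial] at ht
    exact hcon t 1 (Or.inr one_ne_zero) (by simpa using ht)
  obtain ⟨c, hc⟩ : ∃ c, (MvPolynomial.aeval ![Polynomial.X, 1] F : Polynomial ℂ) = Polynomial.C c :=
    ⟨_, Polynomial.eq_C_of_degree_eq_zero hdeg⟩
  have hval : ∀ t : ℂ, eval ![t, 1] F = c := by
    intro t
    have := eval_aeval_polynomial F Polynomial.X 1 t
    rw [hc] at this
    simpa using this.symm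
  have hq : (MvPolynomial.aeval ![1, Polynomial.X] F : Polynomial ℂ) = Polynomial.C c * Polynomial.X ^ n := by
    refine Polynomial.eq_of_infinite_eval_eq _ _
      ((Set.finite_singleton (0 : ℂ)).infinite_compl.mono fun s hs => ?_)
    have hs0 : s ≠ 0 := hs
    have h1 := hF.eval_smul s ![s⁻¹, 1]
    rw [hval] at h1
    rw [Set.mem_ofPred_eq, eval_aeval_polynomial]
    simpa [hs0, mul_comm c] using h1
  have h0 := eval_aeval_polynomial F 1 Polynomial.X 0
  rw [hq] at h0
  exact hcon 1 0 (Or.inl one_ne_zero) (by simpa [hn] using h0.symm)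

theorem IsHomogeneous.eval_ne_zero {σ : Type*} {F : MvPolynomial σ ℂ} (hF : F.IsHomogeneous 0)
    (hF0 : F ≠ 0) (v : σ → ℂ) : eval v F ≠ 0 := by
  have h := totalDegree_eq_zero_iff_eq_C.1 (F.totalDegree_zero_iff_isHomogeneous.2 hF)
  rw [h] at hF0 ⊢
  simpa using hF0

end MvPolynomial

open MvPolynomial in
theorem binaryRootMultiplicity_eq {L H : MvPolynomial (Fin 2) ℂ} {a b : ℂ} {α : ℕ}
    (hab : a ≠ 0 ∨ b ≠ 0) (hL : L = binaryLinearForm a b ^ α * H) (hH : eval ![a, b] H ≠ 0) :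
    binaryRootMultiplicity L a b = α := by
  refine multiplicity_eq_of_dvd_of_not_dvd (a := binaryLinearForm a b) (hL ▸ dvd_mul_right _ _) ?_
  rintro ⟨K, hK⟩
  rw [hL, pow_succ, mul_assoc] at hK
  have := mul_left_cancel₀ (pow_ne_zero _ (binaryLinearForm_ne_zero hab)) hK
  apply hH
  rw [this, map_mul, eval_binaryLinearForm]
  simp [mul_comm]

open MvPolynomial in
-- Linear factors are split off while the cofactor still vanishes at (a, b); the degree bounds their
-- number.
theorem exists_eq_pow_binaryRootMultiplicity_mul {L : MvPolynomial (Fin 2) ℂ} {n : ℕ}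
    (hL : L.IsHomogeneous n) (hL0 : L ≠ 0) {a b : ℂ} (hab : a ≠ 0 ∨ b ≠ 0) :
    ∃ H, L = binaryLinearForm a b ^ binaryRootMultiplicity L a b * H ∧ eval ![a, b] H ≠ 0 ∧
      ∃ m, H.IsHomogeneous m := by
  suffices h : ∃ α H, L = binaryLinearForm a b ^ α * H ∧ eval ![a, b] H ≠ 0 ∧
      ∃ m, H.IsHomogeneous m by
    obtain ⟨α, H, h1, h2, h3⟩ := h
    exact ⟨H, by rwa [binaryRootMultiplicity_eq hab h1 h2], h2, h3⟩
  induction n generalizing L with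
  | zero =>
    exact ⟨0, L, by simp, hL.eval_ne_zero hL0 _, 0, hL⟩
  | succ n ih =>
    by_cases h : eval ![a, b] L = 0
    · obtain ⟨K, e, hK, hLK, he⟩ := hL.exists_cofactor (isHomogeneous_binaryLinearForm a b) hL0
        (hL.binaryLinearForm_dvd hab h)
      obtain rfl : e = n := by omega
      obtain ⟨α, H, h1, h2, h3⟩ := ih hK (by rintro rfl; simp [hLK] at hL0)
      exact ⟨α + 1, H, by rw [hLK, pow_succ', mul_assoc, ← h1], h2, h3⟩
    · exact ⟨0, L, by simp, h, n + 1, hL⟩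

open MvPolynomial in
theorem one_le_binaryRootMultiplicity_iff {L : MvPolynomial (Fin 2) ℂ} {n : ℕ}
    (hL : L.IsHomogeneous n) (hL0 : L ≠ 0) {a b : ℂ} (hab : a ≠ 0 ∨ b ≠ 0) :
    1 ≤ binaryRootMultiplicity L a b ↔ eval ![a, b] L = 0 := by
  obtain ⟨H, h1, h2, -⟩ := exists_eq_pow_binaryRootMultiplicity_mul hL hL0 hab
  have he := congrArg (eval ![a, b]) h1
  rw [map_mul, map_pow, eval_binaryLinearForm] at he
  simp only [Matrix.cons_val_zero, Matrix.cons_val_one, Matrix.cons_val_fin_one,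
    mul_comm b a, sub_self] at he
  constructor
  · intro h
    rw [he, zero_pow (by omega), zero_mul]
  · intro h
    by_contra hlt
    rw [show binaryRootMultiplicity L a b = 0 by omega, pow_zero, one_mul, h] at he
    exact h2 he.symm

open MvPolynomial in
/-- The multiplicity of a root after multiplication by a linear form. -/
theorem binaryRootMultiplicity_linear_mul {K : MvPolynomial (Fin 2) ℂ} {n : ℕ}
    (hK : K.IsHomogeneous n) (hK0 : K ≠ 0) {a b a' b' : ℂ} (hab : a ≠ 0 ∨ b ≠ 0)
    (hne : b' * a - a' * b ≠ 0) :
    binaryRootMultiplicity (binaryLinearForm a' b' * K) a b = binaryRootMultiplicity K a b := by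
  obtain ⟨H, h1, h2, -⟩ := exists_eq_pow_binaryRootMultiplicity_mul hK hK0 hab
  refine binaryRootMultiplicity_eq (H := binaryLinearForm a' b' * H) hab ?_ ?_
  · conv_lhs => rw [h1]
    ring
  · rw [map_mul, eval_binaryLinearForm]
    exact mul_ne_zero (by simpa using hne) h2

open MvPolynomial in
theorem binaryRootMultiplicity_self_mul {K : MvPolynomial (Fin 2) ℂ} {n : ℕ}
    (hK : K.IsHomogeneous n) (hK0 : K ≠ 0) {a b : ℂ} (hab : a ≠ 0 ∨ b ≠ 0) :
    binaryRootMultiplicity (binaryLinearForm a b * K) a b = binaryRootMultiplicity K a b + 1 := by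
  obtain ⟨H, h1, h2, -⟩ := exists_eq_pow_binaryRootMultiplicity_mul hK hK0 hab
  refine binaryRootMultiplicity_eq (H := H) hab ?_ h2
  rw [pow_succ', mul_assoc, ← h1]

/-! ### Points of Λ and the sum of the multiplicities -/

theorem lineLambda_rep_ne_zero {P : P3} (hP : P ∈ lineLambda) : P.rep 0 ≠ 0 ∨ P.rep 1 ≠ 0 := by
  by_contra! h
  refine P.rep_nonzero (funext fun i => ?_)
  fin_cases i
  · exact h.1
  · exact h.2
  · exact hP.1
  · exact hP.2

/-- Points of the line are equal if their first coordinates are proportional. -/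
theorem lineLambda_eq_of_det_eq_zero {P Q : P3} (hP : P ∈ lineLambda) (hQ : Q ∈ lineLambda)
    (h : Q.rep 1 * P.rep 0 - Q.rep 0 * P.rep 1 = 0) : P = Q := by
  rw [← P.mk_rep, ← Q.mk_rep, Projectivization.mk_eq_mk_iff']
  obtain ⟨hP2, hP3⟩ := hP
  obtain ⟨hQ2, hQ3⟩ := id hQ
  rcases lineLambda_rep_ne_zero hQ with h0 | h0
  · refine ⟨P.rep 0 / Q.rep 0, funext fun i => ?_⟩
    fin_cases i <;> simp [hP2, hP3, hQ2, hQ3]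
    · field_simp
    · field_simp
      linear_combination h
  · refine ⟨P.rep 1 / Q.rep 1, funext fun i => ?_⟩
    fin_cases i <;> simp [hP2, hP3, hQ2, hQ3]
    · field_simp
      linear_combination -h
    · field_simp

/-- Every point `(a : b)` gives a point of the line. -/
theorem exists_lineLambda_rep {a b : ℂ} (hab : a ≠ 0 ∨ b ≠ 0) :
    ∃ P ∈ lineLambda, ∃ c : ℂ, P.rep 0 = c * a ∧ P.rep 1 = c * b := by
  have hv : (![a, b, 0, 0] : Fin 4 → ℂ) ≠ 0 := by
    intro h
    have h0 := congrFun h 0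
    have h1 := congrFun h 1
    simp at h0 h1
    tauto
  obtain ⟨c, hc⟩ := Projectivization.exists_smul_eq_mk_rep ℂ _ hv
  refine ⟨Projectivization.mk ℂ _ hv, ⟨?_, ?_⟩, c, ?_, ?_⟩ <;> rw [← hc] <;> simp [Units.smul_def]

open MvPolynomial Classical in
/-- The multiplicities of the roots of a binary form add up to its degree. -/
theorem finsum_binaryRootMultiplicity {L : MvPolynomial (Fin 2) ℂ} {n : ℕ}
    (hL : L.IsHomogeneous n) (hL0 : L ≠ 0) :
    {P | P ∈ lineLambda ∧ eval ![P.rep 0, P.rep 1] L = 0}.Finite ∧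
    ∑ᶠ P ∈ {P | P ∈ lineLambda ∧ eval ![P.rep 0, P.rep 1] L = 0},
      binaryRootMultiplicity L (P.rep 0) (P.rep 1) = n := by
  have hsupp : ∀ {K : MvPolynomial (Fin 2) ℂ} {m : ℕ}, K.IsHomogeneous m → K ≠ 0 →
      Function.support (fun P : P3 => if P ∈ lineLambda then
        binaryRootMultiplicity K (P.rep 0) (P.rep 1) else 0)
      = {P | P ∈ lineLambda ∧ eval ![P.rep 0, P.rep 1] K = 0} := by
    intro K m hK hK0
    ext P
    simp only [Function.mem_support, Set.mem_ofPred_eq]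
    by_cases hP : P ∈ lineLambda
    · rw [if_pos hP, ← one_le_binaryRootMultiplicity_iff hK hK0 (lineLambda_rep_ne_zero hP)]
      simp [hP, Nat.one_le_iff_ne_zero]
    · simp [hP]
  -- Extended by zero, the multiplicity has the root set as its support. The summation domain then
  -- no longer depends on the form, which suits induction on the degree.
  suffices h : (Function.support (fun P : P3 => if P ∈ lineLambda then
        binaryRootMultiplicity L (P.rep 0) (P.rep 1) else 0)).Finite ∧
      ∑ᶠ P : P3, (if P ∈ lineLambda then
        binaryRootMultiplicity L (P.rep 0) (P.rep 1) else 0) = n by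
    rw [hsupp hL hL0] at h
    refine ⟨h.1, ?_⟩
    rw [← h.2, finsum_mem_def]
    refine finsum_congr fun P => ?_
    rw [← hsupp hL hL0, Set.indicator_apply]
    by_cases hP : P ∈ lineLambda <;> simp [hP]
    exact fun h => h.symm
  induction n generalizing L with
  | zero =>
    have hz : ∀ P : P3, (if P ∈ lineLambda then
        binaryRootMultiplicity L (P.rep 0) (P.rep 1) else 0) = 0 := by
      intro P
      split_ifs with hP
      · have h := one_le_binaryRootMultiplicity_iff hL hL0 (lineLambda_rep_ne_zero hP)
        rw [← not_iff_not] at h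
        have := h.2 (hL.eval_ne_zero hL0 _)
        omega
      · rfl
    simp only [hz]
    simp
  | succ n ih =>
    obtain ⟨a, b, hab, hev⟩ := hL.exists_eval_eq_zero (Nat.succ_ne_zero n)
    obtain ⟨Q, hQ, c, hQ0, hQ1⟩ := exists_lineLambda_rep hab
    have hQL : eval ![Q.rep 0, Q.rep 1] L = 0 := by
      have := hL.eval_smul c ![a, b]
      rw [hev, mul_zero] at this
      rw [← this, hQ0, hQ1]
      simp
    obtain ⟨K, e, hK, hLK, he⟩ := hL.exists_cofactor
      (isHomogeneous_binaryLinearForm (Q.rep 0) (Q.rep 1)) hL0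
      (hL.binaryLinearForm_dvd (lineLambda_rep_ne_zero hQ) hQL)
    obtain rfl : e = n := by omega
    have hK0 : K ≠ 0 := by rintro rfl; simp [hLK] at hL0
    obtain ⟨h1, h2⟩ := ih hK hK0
    -- The factor vanishing at Q raises the multiplicity by one at Q and nowhere else.
    have hstep : (fun P : P3 => if P ∈ lineLambda then
        binaryRootMultiplicity L (P.rep 0) (P.rep 1) else 0) = fun P : P3 =>
        (if P ∈ lineLambda then binaryRootMultiplicity K (P.rep 0) (P.rep 1) else 0)
          + if P = Q then 1 else 0 := by
      funext P
      by_cases hP : P ∈ lineLambda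
      · rw [if_pos hP, if_pos hP, hLK]
        by_cases hPQ : P = Q
        · rw [if_pos hPQ, hPQ]
          exact binaryRootMultiplicity_self_mul hK hK0 (lineLambda_rep_ne_zero hQ)
        · rw [if_neg hPQ, add_zero]
          exact binaryRootMultiplicity_linear_mul hK hK0 (lineLambda_rep_ne_zero hP)
            fun h => hPQ (lineLambda_eq_of_det_eq_zero hP hQ h)
      · rw [if_neg hP, if_neg hP, if_neg (fun h : P = Q => hP (by rwa [h]))]
    have hs : (Function.support fun P : P3 => if P = Q then 1 else 0).Finite :=
      (Set.finite_singleton Q).subset fun P hP => by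
        by_contra hPQ
        exact hP (if_neg hPQ)
    rw [hstep]
    refine ⟨(h1.union hs).subset (Function.support_add _ _), ?_⟩
    rw [finsum_add_distrib h1 hs, h2, finsum_eq_single _ Q fun P hP => if_neg hP, if_pos rfl]

/-! ### The surface along Λ -/

open MvPolynomial in
theorem eval_surfaceForm (d : ℕ) (L : MvPolynomial (Fin 2) ℂ) (L₂ : MvPolynomial (Fin 3) ℂ)
    (L₃ : MvPolynomial (Fin 4) ℂ) (v : Fin 4 → ℂ) :
    eval v (surfaceForm d L L₂ L₃) = v 2 * (v 3 * eval v L₃ + v 2 * eval ![v 0, v 1, v 2] L₂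
      + eval ![v 0, v 1] L) + v 3 ^ d := by
  have h2 : v ∘ (Fin.castLE (by norm_num) : Fin 2 → Fin 4) = ![v 0, v 1] := by
    ext i
    fin_cases i <;> rfl
  have h3 : v ∘ (Fin.castLE (by norm_num) : Fin 3 → Fin 4) = ![v 0, v 1, v 2] := by
    ext i
    fin_cases i <;> rfl
  simp [surfaceForm, eval_rename, h2, h3]

open MvPolynomial in
/-- On the line, only the derivative of the equation with respect to `X₂` can be nonzero. -/
theorem eval_pderiv_surfaceForm {d : ℕ} (hd : 3 ≤ d) (L : MvPolynomial (Fin 2) ℂ)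
    (L₂ : MvPolynomial (Fin 3) ℂ) (L₃ : MvPolynomial (Fin 4) ℂ) {v : Fin 4 → ℂ}
    (h2 : v 2 = 0) (h3 : v 3 = 0) (i : Fin 4) :
    eval v (pderiv i (surfaceForm d L L₂ L₃)) = if i = 2 then eval ![v 0, v 1] L else 0 := by
  have hL : v ∘ (Fin.castLE (by norm_num) : Fin 2 → Fin 4) = ![v 0, v 1] := by
    ext i
    fin_cases i <;> rfl
  have hd1 : d - 1 ≠ 0 := by omega
  simp only [surfaceForm, map_add, Derivation.leibniz, Derivation.leibniz_pow, smul_eq_mul,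
    nsmul_eq_mul, map_mul, map_pow, eval_X, h2, h3, zero_mul, zero_pow hd1, mul_zero, zero_add,
    add_zero, pderiv_X, eval_rename, hL]
  by_cases hi : i = 2
  · simp [hi]
  · simp [hi, Ne.symm hi]

open MvPolynomial in
theorem mem_singLocus_surfaceForm_iff {d : ℕ} (hd : 3 ≤ d) (L : MvPolynomial (Fin 2) ℂ)
    (L₂ : MvPolynomial (Fin 3) ℂ) (L₃ : MvPolynomial (Fin 4) ℂ) {P : P3} (hP : P ∈ lineLambda) :
    P ∈ singLocus (surfaceForm d L L₂ L₃) ↔ eval ![P.rep 0, P.rep 1] L = 0 := by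
  simp only [singLocus, projHypersurface, Set.mem_ofPred_eq, eval_surfaceForm,
    eval_pderiv_surfaceForm hd L L₂ L₃ hP.1 hP.2]
  simp [hP.1, hP.2, show d ≠ 0 by omega]

open MvPolynomial in
theorem isStarPoint_surfaceForm {d : ℕ} (hd : 3 ≤ d) (L : MvPolynomial (Fin 2) ℂ)
    (L₂ : MvPolynomial (Fin 3) ℂ) (L₃ : MvPolynomial (Fin 4) ℂ) {P : P3} (hP : P ∈ lineLambda)
    (hs : P ∉ singLocus (surfaceForm d L L₂ L₃)) : IsStarPoint (surfaceForm d L L₂ L₃) P := by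
  have hL := hs
  rw [mem_singLocus_surfaceForm_iff hd L L₂ L₃ hP] at hL
  have hT : ∀ v, v ∈ embeddedTangentSpace (surfaceForm d L L₂ L₃) P ↔ v 2 = 0 := by
    intro v
    change ∑ i, eval P.rep (pderiv i (surfaceForm d L L₂ L₃)) * v i = 0 ↔ _
    simp only [eval_pderiv_surfaceForm hd L L₂ L₃ hP.1 hP.2]
    simp [hL]
  refine ⟨?_, hs, (hT _).2 hP.1, fun v hv t => ?_⟩
  · change eval _ _ = 0
    rw [eval_surfaceForm]
    simp [hP.1, hP.2, show d ≠ 0 by omega]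
  · rw [hT] at hv
    simp [eval_surfaceForm, hv, hP.1, hP.2]

open MvPolynomial in
-- Treats the charts X₀ ≠ 0 and X₁ ≠ 0 together: in both, the last two coordinates come from X₂ and
-- X₃, and b X₀ - a X₁ becomes c times a coordinate centred at P. The local lemma applies with M, N,
-- h given by L₃, L₂, c ^ α H.
theorem isTypeA_surfaceForm_of_chart {d e : ℕ} (hd : 3 ≤ d) {L H : MvPolynomial (Fin 2) ℂ}
    {L₂ : MvPolynomial (Fin 3) ℂ} {L₃ : MvPolynomial (Fin 4) ℂ} (hL₃ : L₃.IsHomogeneous e)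
    {P : P3} (hP : P ∈ lineLambda) (hP3 : eval P.rep L₃ ≠ 0) {α m : ℕ} (hα : 1 ≤ α)
    (hH : H.IsHomogeneous m) (hLH : L = binaryLinearForm (P.rep 0) (P.rep 1) ^ α * H)
    (hPH : eval ![P.rep 0, P.rep 1] H ≠ 0) {i : Fin 4} (hi : P.rep i ≠ 0)
    (h2 : ∀ x : Fin 3 → ℂ, (i.insertNth (1 : ℂ) x : Fin 4 → ℂ) 2 = x 1)
    (h3 : ∀ x : Fin 3 → ℂ, (i.insertNth (1 : ℂ) x : Fin 4 → ℂ) 3 = x 2)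
    {c : ℂ} (hc : c ≠ 0) (hlin : ∀ x : Fin 3 → ℂ,
      P.rep 1 * (i.insertNth (1 : ℂ) x : Fin 4 → ℂ) 0
        - P.rep 0 * (i.insertNth (1 : ℂ) x : Fin 4 → ℂ) 1
        = c * (x 0 - P.rep (i.succAbove 0) / P.rep i)) :
    IsTypeA (d * α - 1) (surfaceForm d L L₂ L₃) P := by
  refine ⟨i, hi, ?_⟩
  set p : Fin 3 → ℂ := fun j => P.rep (i.succAbove j) / P.rep i with hp
  have hvp : (i.insertNth (1 : ℂ) p : Fin 4 → ℂ) = (P.rep i)⁻¹ • P.rep := by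
    ext j
    rcases Fin.eq_self_or_eq_succAbove i j with rfl | ⟨j, rfl⟩
    · simp [hi]
    · simp [hp, div_eq_inv_mul]
  have hvan : ∀ j : Fin 4,
      AnalyticAt ℂ (fun x : Fin 3 → ℂ => (i.insertNth (1 : ℂ) x : Fin 4 → ℂ) j) p := by
    intro j
    rcases Fin.eq_self_or_eq_succAbove i j with rfl | ⟨j, rfl⟩
    · simpa using analyticAt_const
    · simp only [Fin.insertNth_apply_succAbove]
      exact (ContinuousLinearMap.proj (R := ℂ) (φ := fun _ : Fin 3 => ℂ) j).analyticAt p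
  have hp1 : p 1 = 0 := by
    rw [← h2 p, hvp]
    simp [hP.1]
  have hp2 : p 2 = 0 := by
    rw [← h3 p, hvp]
    simp [hP.2]
  have key := isTypeAGerm_of_unit (d := d) (α := α) (a := p) hd hα hp1 hp2
    (M := fun x => eval (i.insertNth (1 : ℂ) x : Fin 4 → ℂ) L₃)
    (N := fun x => eval ![(i.insertNth (1 : ℂ) x : Fin 4 → ℂ) 0,
      (i.insertNth (1 : ℂ) x : Fin 4 → ℂ) 1, (i.insertNth (1 : ℂ) x : Fin 4 → ℂ) 2] L₂)
    (h := fun x => c ^ α * eval ![(i.insertNth (1 : ℂ) x : Fin 4 → ℂ) 0,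
      (i.insertNth (1 : ℂ) x : Fin 4 → ℂ) 1] H) ?_ ?_ ?_ ?_ ?_
  · convert key using 2 with x
    rw [eval_surfaceForm, h2, h3, hLH, map_mul, map_pow, eval_binaryLinearForm]
    simp only [Matrix.cons_val_zero, Matrix.cons_val_one, Matrix.cons_val_fin_one, hlin, mul_pow]
    ring
  · simpa [coe_aeval_eq_eval] using AnalyticAt.aeval_mvPolynomial hvan L₃
  · have := AnalyticAt.aeval_mvPolynomial (𝕜 := ℂ) (z := p) (f := fun x : Fin 3 → ℂ =>
      ![(i.insertNth (1 : ℂ) x : Fin 4 → ℂ) 0, (i.insertNth (1 : ℂ) x : Fin 4 → ℂ) 1,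
        (i.insertNth (1 : ℂ) x : Fin 4 → ℂ) 2]) (by
          intro j
          fin_cases j
          · exact hvan 0
          · exact hvan 1
          · exact hvan 2) L₂
    simpa [coe_aeval_eq_eval] using this
  · have := AnalyticAt.aeval_mvPolynomial (𝕜 := ℂ) (z := p) (f := fun x : Fin 3 → ℂ =>
      ![(i.insertNth (1 : ℂ) x : Fin 4 → ℂ) 0, (i.insertNth (1 : ℂ) x : Fin 4 → ℂ) 1]) (by
          intro j
          fin_cases j
          · exact hvan 0
          · exact hvan 1) H
    exact analyticAt_const.mul (by simpa [coe_aeval_eq_eval] using this)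
  · rw [hvp, hL₃.eval_smul]
    exact mul_ne_zero (pow_ne_zero _ (inv_ne_zero hi)) hP3
  · refine mul_ne_zero (pow_ne_zero _ hc) ?_
    rw [hvp]
    have : ![((P.rep i)⁻¹ • P.rep) 0, ((P.rep i)⁻¹ • P.rep) 1]
        = (P.rep i)⁻¹ • ![P.rep 0, P.rep 1] := by simp
    rw [this, hH.eval_smul]
    exact mul_ne_zero (pow_ne_zero _ (inv_ne_zero hi)) hPH

open MvPolynomial in
theorem isTypeA_surfaceForm {d e n : ℕ} (hd : 3 ≤ d) {L : MvPolynomial (Fin 2) ℂ}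
    (hL : L.IsHomogeneous n) (hL0 : L ≠ 0)
    {L₂ : MvPolynomial (Fin 3) ℂ} {L₃ : MvPolynomial (Fin 4) ℂ} (hL₃ : L₃.IsHomogeneous e)
    {P : P3} (hP : P ∈ lineLambda) (hP3 : eval P.rep L₃ ≠ 0)
    (hα : 1 ≤ binaryRootMultiplicity L (P.rep 0) (P.rep 1)) :
    IsTypeA (d * binaryRootMultiplicity L (P.rep 0) (P.rep 1) - 1) (surfaceForm d L L₂ L₃) P := by
  obtain ⟨H, h1, h2, m, hH⟩ :=
    exists_eq_pow_binaryRootMultiplicity_mul hL hL0 (lineLambda_rep_ne_zero hP)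
  rcases lineLambda_rep_ne_zero hP with h | h
  · refine isTypeA_surfaceForm_of_chart hd hL₃ hP hP3 hα hH h1 h2 (i := 0) h (fun x => rfl)
      (fun x => rfl) (c := -P.rep 0) (neg_ne_zero.2 h) fun x => ?_
    change P.rep 1 * 1 - P.rep 0 * x 0 = -P.rep 0 * (x 0 - P.rep 1 / P.rep 0)
    field_simp
    ring
  · refine isTypeA_surfaceForm_of_chart hd hL₃ hP hP3 hα hH h1 h2 (i := 1) h (fun x => rfl)
      (fun x => rfl) (c := P.rep 1) h fun x => ?_
    change P.rep 1 * x 0 - P.rep 0 * 1 = P.rep 1 * (x 0 - P.rep 0 / P.rep 1)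
    field_simp

/-! ### Genericity and conclusion -/

open MvPolynomial in
/-- The value at a point of a quaternary form is a nonzero polynomial in its coefficients. -/
theorem exists_polynomial_eval_eq (e : ℕ) (P : P3) :
    ∃ G : MvPolynomial (MonomialIndex 3 e ⊕ MonomialIndex 4 e) ℂ, G ≠ 0 ∧
      ∀ (L₂ : MvPolynomial (Fin 3) ℂ) (L₃ : MvPolynomial (Fin 4) ℂ), L₃.IsHomogeneous e →
        eval (Sum.elim (fun m => L₂.coeff m.1) (fun m => L₃.coeff m.1)) G = eval P.rep L₃ := by
  have hfin : {m : Fin 4 →₀ ℕ | m.degree = e}.Finite := Finsupp.finite_of_degree_eq e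
  let _ : Fintype (MonomialIndex 4 e) := hfin.fintype
  let G : MvPolynomial (MonomialIndex 3 e ⊕ MonomialIndex 4 e) ℂ :=
    ∑ m : MonomialIndex 4 e, C (∏ i, P.rep i ^ m.1 i) * X (Sum.inr m)
  have hG : ∀ (L₂ : MvPolynomial (Fin 3) ℂ) (L₃ : MvPolynomial (Fin 4) ℂ), L₃.IsHomogeneous e →
      eval (Sum.elim (fun m => L₂.coeff m.1) (fun m => L₃.coeff m.1)) G = eval P.rep L₃ := by
    intro L₂ L₃ h
    rw [eval_eq' P.rep, map_sum]
    simp only [map_mul, eval_C, eval_X, Sum.elim_inr]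
    rw [← Finset.sum_subtype hfin.toFinset (fun m => by simp)
      (fun m => (∏ i, P.rep i ^ m i) * L₃.coeff m)]
    symm
    refine Finset.sum_subset_zero_on_sdiff (fun m hm => ?_) (fun m hm => ?_) (fun m _ => mul_comm _ _)
    · rw [Set.Finite.mem_toFinset, Set.mem_ofPred_eq]
      by_contra hne
      exact (mem_support_iff.1 hm) (h.coeff_eq_zero hne)
    · rw [notMem_support_iff.1 (Finset.mem_sdiff.1 hm).2, mul_zero]
  refine ⟨G, fun h0 => ?_, hG⟩
  -- G ≠ 0 since the form `X i ^ e` does not vanish at P for a nonzero coordinate i.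
  obtain ⟨i, hi⟩ := Function.ne_iff.1 P.rep_nonzero
  have := hG 0 (X i ^ e) (isHomogeneous_X_pow i e)
  rw [h0, map_zero, map_pow, eval_X] at this
  exact pow_ne_zero e hi this.symm

open MvPolynomial in
theorem mainTheorem8 (d : ℕ) (hd : 3 ≤ d) (L : MvPolynomial (Fin 2) ℂ)
    (hL : L.IsHomogeneous (d - 1)) (hL0 : L ≠ 0) :
    ForGeneralForms (d - 2) (fun L₂ L₃ =>
      (∀ P ∈ lineLambda, P ∉ singLocus (surfaceForm d L L₂ L₃) →
        IsStarPoint (surfaceForm d L L₂ L₃) P) ∧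
      ∃ k : P3 → ℕ,
        (∀ P ∈ lineLambda ∩ singLocus (surfaceForm d L L₂ L₃),
          1 ≤ binaryRootMultiplicity L (P.rep 0) (P.rep 1) ∧
          k P = d * binaryRootMultiplicity L (P.rep 0) (P.rep 1) - 1 ∧
          IsTypeA (k P) (surfaceForm d L L₂ L₃) P) ∧
        (lineLambda ∩ singLocus (surfaceForm d L L₂ L₃)).Finite ∧
        ∑ᶠ P ∈ lineLambda ∩ singLocus (surfaceForm d L L₂ L₃),
          ((k P : ℚ) + 1) / (d : ℚ) = (d : ℚ) - 1) := by
  obtain ⟨hfin, hsum⟩ := finsum_binaryRootMultiplicity hL hL0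
  choose G hG0 hG using exists_polynomial_eval_eq (d - 2)
  -- Nonvanishing of this product says that L₃ is nonzero at every root of L on Λ.
  refine ⟨∏ P ∈ hfin.toFinset, G P, Finset.prod_ne_zero_iff.2 fun P _ => hG0 P, ?_⟩
  intro L₂ L₃ _ hL₃ hne
  rw [map_prod, Finset.prod_ne_zero_iff] at hne
  have hset : lineLambda ∩ singLocus (surfaceForm d L L₂ L₃)
      = {P | P ∈ lineLambda ∧ eval ![P.rep 0, P.rep 1] L = 0} := by
    ext P
    exact and_congr_right fun hP => mem_singLocus_surfaceForm_iff hd L L₂ L₃ hP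
  refine ⟨fun P hP hs => isStarPoint_surfaceForm hd L L₂ L₃ hP hs,
    fun P => d * binaryRootMultiplicity L (P.rep 0) (P.rep 1) - 1, ?_⟩
  rw [hset]
  have hone : ∀ P ∈ {P | P ∈ lineLambda ∧ eval ![P.rep 0, P.rep 1] L = 0},
      1 ≤ binaryRootMultiplicity L (P.rep 0) (P.rep 1) := fun P hP =>
    (one_le_binaryRootMultiplicity_iff hL hL0 (lineLambda_rep_ne_zero hP.1)).2 hP.2
  refine ⟨fun P hP => ⟨hone P hP, rfl, isTypeA_surfaceForm hd hL hL0 hL₃ hP.1 ?_ (hone P hP)⟩,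
    hfin, ?_⟩
  · rw [← hG P L₂ L₃ hL₃]
    exact hne P (hfin.mem_toFinset.2 hP)
  · have hd0 : (d : ℚ) ≠ 0 := by
      exact_mod_cast (by omega : d ≠ 0)
    have hterm : ∀ P ∈ {P | P ∈ lineLambda ∧ eval ![P.rep 0, P.rep 1] L = 0},
        (((d * binaryRootMultiplicity L (P.rep 0) (P.rep 1) - 1 : ℕ) : ℚ) + 1) / d
          = (binaryRootMultiplicity L (P.rep 0) (P.rep 1) : ℚ) := by
      intro P hP
      -- Ensures that the subtraction in dα - 1 is not truncated.
      have : 1 ≤ d * binaryRootMultiplicity L (P.rep 0) (P.rep 1) :=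
        Nat.mul_pos (by omega) (hone P hP)
      rw [Nat.cast_sub this]
      push_cast
      field_simp
      ring
    rw [finsum_mem_congr rfl hterm, finsum_mem_eq_finite_toFinset_sum _ hfin, ← Nat.cast_sum,
      ← finsum_mem_eq_finite_toFinset_sum _ hfin, hsum, Nat.cast_sub (by omega), Nat.cast_one]
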